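/- For every $n$ let $\mathcal D_n=(d^{(n)}_1,\dots,d^{(n)}_n)$ be a sequence of non-negative integers that is the degree sequence of at least one simple graph on $[n]$. Let $G(\mathcal D_n)$ be chosen uniformly at random among all simple graphs on $[n]$ in which vertex $i$ has degree $d^{(n)}_i$ for all $i\in[n]$. For $p=p(n)\in[0,1]$ let $G(\mathcal D_n)_p$ be the random subgraph of $G(\mathcal D_n)$ on $[n]$ in which each edge of $G(\mathcal D_n)$ is kept independently with probability $p$. Write $L_1(H)$ for the order (number of vertices) of a largest connected component of a graph $H$, and for $d=d(n)>0$ let $S_n(d)=\{i\in[n]: d^{(n)}_i\ge d(n)\}$. For non-negative functions $f,g$ of $n$, $f\ll g$ (equivalently $g\gg f$) means that for every $\varepsilon>0$ one has $f(n)\le\varepsilon g(n)$ for all sufficiently large $n$; a.a.s. means with probability tending to $1$ as $n\to\infty$. Theorem 1 (Percolation threshold for $\delta$-large). Suppose that there are $\delta\ge 0$ and $d=d(n)>0$ such that $|S_n(d)|=\delta n+o(n)$. (a) If $p\ll 1/d$, then a.a.s. $L_1(G(\mathcal D_n)_p)\le \delta n+o(n)$; that is, there is a deterministic function $f(n)=o(n)$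 with $\mathbb P[L_1(G(\mathcal D_n)_p)\le\delta n+f(n)]\to 1$. (b) If $p\gg 1/d$, then a.a.s. $L_1(G(\mathcal D_n)_p)\ge \delta n-o(n)$; that is, there is a deterministic function $f(n)=o(n)$ with $\mathbb P[L_1(G(\mathcal D_n)_p)\ge\delta n-f(n)]\to 1$. Moreover, if $\delta>0$, then a.a.s. a $(1-o(1))$-proportion of the vertices of $S_n(d)$ lies in a single component of $G(\mathcal D_n)_p$; that is, there is $\varepsilon(n)\to 0$ such that, with probability tending to $1$, some component contains at least $(1-\varepsilon(n))|S_n(d)|$ vertices of $S_n(d)$. -/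

import Mathlib

open Filter Topology MeasureTheory ProbabilityTheory

namespace DegreePercolation

/-- The set of all simple graphs on `Fin n` in which vertex `i` has degree `D i` for all `i`. -/
def realizations {n : ℕ} (D : Fin n → ℕ) : Set (SimpleGraph (Fin n)) :=
  open Classical in {G | ∀ i, G.degree i = D i}

/-- A degree sequence is feasible if at least one simple graph realizes it. -/
def Feasible {n : ℕ} (D : Fin n → ℕ) : Prop :=
  (realizations D).Nonempty

/-- The set of vertices of degree at least `d`; it is the same in every realization of `D`. -/
def highDegree {n : ℕ} (D : Fin n → ℕ) (d : ℝ) : Set (Fin n) :=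
  {i | d ≤ (D i : ℝ)}

/-- Law of the bond percolation of the graph `G` with parameter `p`: the edge set is a random
subset of the edge set of `G` containing each edge independently with probability `p`. -/
noncomputable def percolation {V : Type*} (G : SimpleGraph V) (p : unitInterval) :
    Measure (SimpleGraph V) :=
  (setBernoulli G.edgeSet p).map SimpleGraph.fromEdgeSet

/-- Law of the percolated random graph: first a graph with degree sequence `D` is chosen uniformly
at random, then it is percolated with parameter `p`. -/
noncomputable def percolatedLaw {n : ℕ} (D : Fin n → ℕ) (p : unitInterval) :
    Measure (SimpleGraph (Fin n)) :=
  (uniformOn (realizations D)).bind fun G => percolation G p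

/-- The order of a largest connected component of a finite graph (`0` for the empty graph). -/
noncomputable def largestComponent {V : Type*} [Finite V] (G : SimpleGraph V) : ℕ :=
  ⨆ c : G.ConnectedComponent, c.supp.ncard

/-- The events `A n` hold asymptotically almost surely under the laws `μ n`. -/
def AAS {Ω : ℕ → Type*} [∀ n, MeasurableSpace (Ω n)] (μ : ∀ n, Measure (Ω n))
    (A : ∀ n, Set (Ω n)) : Prop :=
  Tendsto (fun n => μ n (A n)) atTop (𝓝 1)

end DegreePercolation

/-! Write `S` for the vertices of degree at least `d`. Subcritical case: a vertex outside `S` keeps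
some edge with probability at most `d * p`, which tends to 0. By Markov's inequality only `o(n)`
vertices outside `S` are non-isolated, and a component with more than one vertex lies in `S`
together with these (`largestComponent_le`, `percolatedLaw_card_adj_le`).

Supercritical case: if no component holds `(1 - ε) * |S|` vertices of `S`, some union of components
`X` has at least `t = ε * |S| / 2` vertices of `S` on each side (`exists_balanced_cut`). For fixed
`X`, a switching argument shows that the uniform random graph has at most `t * d / 16` edges across
the cut with probability at most `4 * 2 ^ (-(t * d / 16))` (`card_sparseCut_le`). Otherwise
percolation deletes all crossing edges with probability at most `(1 - p) ^ (t * d / 16)`. With `ε =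
1 / √(d * p)` the resulting bound beats the union bound over `2 ^ n` cuts.

Switching: a graph with a sparse cut admits many exchanges of one edge inside each side for two
crossing edges, while each resulting graph arises in few ways. So allowing two more crossing edges
multiplies the number of graphs by at least 4. -/

namespace DegreePercolation

set_option linter.unusedSectionVars false

/-! ### Switchings, and the rarity of sparse cuts among realizations. -/

section Switching

open Classical Finset

variable {V : Type*}

/-- Replace the edges `ab` and `ce` by `ae` and `cb`. -/
def switch (G : SimpleGraph V) (a b c e : V) : SimpleGraph V :=
  SimpleGraph.fromEdgeSet ((G.edgeSet \ {s(a, b), s(c, e)}) ∪ {s(a, e), s(c, b)})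

/-- A switch is admissible if both old edges are present and both new ones are absent, and the
old edges lie on different sides of the cut. -/
structure Switchable (G : SimpleGraph V) (X : Finset V) (a b c e : V) : Prop where
  ha : a ∈ X
  hb : b ∈ X
  hc : c ∉ X
  he : e ∉ X
  hab : G.Adj a b
  hce : G.Adj c e
  hae : ¬G.Adj a e
  hcb : ¬G.Adj c b

namespace Switchable

variable {G : SimpleGraph V} {X : Finset V} {a b c e : V}

lemma switch_adj (h : Switchable G X a b c e) {u v : V} :
    (switch G a b c e).Adj u v ↔ (G.Adj u v ∧ s(u, v) ≠ s(a, b) ∧ s(u, v) ≠ s(c, e)) ∨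
      s(u, v) = s(a, e) ∨ s(u, v) = s(c, b) := by
  obtain ⟨ha, hb, hc, he, hab, hce, hae, hcb⟩ := h
  have h1 : a ≠ e := by rintro rfl; exact he ha
  have h2 : c ≠ b := by rintro rfl; exact hc hb
  simp only [switch, SimpleGraph.fromEdgeSet_adj, Set.mem_union, Set.mem_sdiff,
    SimpleGraph.mem_edgeSet, Set.mem_insert_iff, Set.mem_singleton_iff, not_or, ne_eq]
  constructor
  · tauto
  · intro h
    refine ⟨by tauto, ?_⟩
    -- `fromEdgeSet` discards loops, but the new pairs join opposite sides of the cut and so are not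
    -- loops.
    rintro rfl
    rcases h with h | h | h
    · exact h.1.ne rfl
    · simp only [Sym2.eq_iff] at h; grind
    · simp only [Sym2.eq_iff] at h; grind

end Switchable

variable [Fintype V] [DecidableEq V]

/-- The pairs of adjacent vertices whose first entry lies in `X` and whose second does not. -/
noncomputable def crossPairs (G : SimpleGraph V) (X : Finset V) : Finset (V × V) :=
  univ.filter fun q => q.1 ∈ X ∧ q.2 ∉ X ∧ G.Adj q.1 q.2

lemma mem_crossPairs {G : SimpleGraph V} {X : Finset V} {q : V × V} :
    q ∈ crossPairs G X ↔ q.1 ∈ X ∧ q.2 ∉ X ∧ G.Adj q.1 q.2 := by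
  simp [crossPairs]

lemma card_crossPairs_compl (G : SimpleGraph V) (X : Finset V) :
    (crossPairs G Xᶜ).card = (crossPairs G X).card := by
  refine card_bij (fun q _ => q.swap) ?_ ?_ ?_
  · rintro ⟨a, b⟩ h
    simp only [mem_crossPairs, mem_compl, not_not, Prod.swap] at h ⊢
    exact ⟨h.2.1, h.1, h.2.2.symm⟩
  · intro a _ b _ h
    exact Prod.swap_injective h
  · rintro ⟨a, b⟩ h
    refine ⟨(b, a), ?_, rfl⟩
    simp only [mem_crossPairs, mem_compl, not_not] at h ⊢
    exact ⟨h.2.1, h.1, h.2.2.symm⟩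

/-- The neighbours of `v` on the other side of the cut given by `X`. -/
noncomputable def crossNeighbors (G : SimpleGraph V) (X : Finset V) (v : V) : Finset V :=
  univ.filter fun w => G.Adj v w ∧ ¬(v ∈ X ↔ w ∈ X)

lemma mem_crossNeighbors {G : SimpleGraph V} {X : Finset V} {v w : V} :
    w ∈ crossNeighbors G X v ↔ G.Adj v w ∧ ¬(v ∈ X ↔ w ∈ X) := by
  simp [crossNeighbors]

lemma crossNeighbors_compl (G : SimpleGraph V) (X : Finset V) (v : V) :
    crossNeighbors G Xᶜ v = crossNeighbors G X v := by
  ext w; simp [mem_crossNeighbors, not_iff_not]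

lemma sum_card_crossNeighbors_le (G : SimpleGraph V) {X A : Finset V} (hA : A ⊆ X) :
    ∑ v ∈ A, (crossNeighbors G X v).card ≤ (crossPairs G X).card := by
  rw [← card_sigma]
  refine card_le_card_of_injOn (fun q => (q.1, q.2)) ?_ ?_
  · rintro ⟨v, w⟩ h
    simp only [coe_sigma, Set.mem_sigma_iff, mem_coe, mem_crossNeighbors] at h
    have := hA h.1
    simp only [mem_coe, mem_crossPairs]
    tauto
  · rintro ⟨a, b⟩ _ ⟨c, e⟩ _ h
    simpa using h

/-- Only few vertices on one side of a sparse cut have many neighbours on the other side. -/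
lemma half_le_card_filter_crossNeighbors (G : SimpleGraph V) {X A : Finset V} (hA : A ⊆ X)
    {t d : ℝ} (hd : 0 < d) (ht : t ≤ A.card) (hK : ((crossPairs G X).card : ℝ) ≤ t * d / 8) :
    t / 2 ≤ (A.filter fun v => ((crossNeighbors G X v).card : ℝ) ≤ d / 4).card := by
  have h1 := card_filter_add_card_filter_not (s := A)
    (fun v => ((crossNeighbors G X v).card : ℝ) ≤ d / 4)
  set B := A.filter fun v => ¬((crossNeighbors G X v).card : ℝ) ≤ d / 4
  -- Each vertex of `B` accounts for more than `d / 4` crossing edges, out of at most `t * d / 8`.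
  have h2 : (B.card : ℝ) * (d / 4) ≤ t * d / 8 := by
    calc (B.card : ℝ) * (d / 4) = ∑ v ∈ B, d / 4 := by simp
      _ ≤ ∑ v ∈ B, ((crossNeighbors G X v).card : ℝ) :=
          sum_le_sum fun v hv => (not_le.1 (mem_filter.1 hv).2).le
      _ ≤ ((crossPairs G X).card : ℝ) := by
          exact_mod_cast sum_card_crossNeighbors_le G ((filter_subset _ _).trans hA)
      _ ≤ _ := hK
  have h3 : (B.card : ℝ) ≤ t / 2 := by
    have : (B.card : ℝ) * (d / 4) ≤ (t / 2) * (d / 4) := by linarith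
    exact le_of_mul_le_mul_right this (by positivity)
  have h4 : ((A.filter fun v => ((crossNeighbors G X v).card : ℝ) ≤ d / 4).card : ℝ) + B.card
      = A.card := by exact_mod_cast h1
  linarith

/-- The neighbours of `v` on its own side of the cut that are not adjacent to `u`. -/
noncomputable def privateNeighbors (G : SimpleGraph V) (X : Finset V) (v u : V) : Finset V :=
  univ.filter fun w => G.Adj v w ∧ (v ∈ X ↔ w ∈ X) ∧ ¬G.Adj u w

lemma mem_privateNeighbors {G : SimpleGraph V} {X : Finset V} {v u w : V} :
    w ∈ privateNeighbors G X v u ↔ G.Adj v w ∧ (v ∈ X ↔ w ∈ X) ∧ ¬G.Adj u w := by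
  simp [privateNeighbors]

/-- A neighbour of `v` on its own side that is also adjacent to `u` is a cross neighbour of `u`,
because `u` is on the other side. -/
lemma degree_le_card_privateNeighbors (G : SimpleGraph V) {X : Finset V} {v u : V}
    (h : ¬(v ∈ X ↔ u ∈ X)) :
    G.degree v ≤ (privateNeighbors G X v u).card + (crossNeighbors G X v).card
      + (crossNeighbors G X u).card := by
  rw [← G.card_neighborFinset_eq_degree]
  refine (card_le_card ?_).trans ((card_union_le _ _).trans
    (Nat.add_le_add_right (card_union_le _ _) _))
  intro w hw
  simp only [SimpleGraph.mem_neighborFinset] at hw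
  simp only [mem_union, mem_privateNeighbors, mem_crossNeighbors]
  tauto

namespace Switchable

variable {G : SimpleGraph V} {X : Finset V} {a b c e : V}

/-- Each of the four vertices trades exactly one neighbour for a new one, so switching stays among
the realizations of the same sequence. -/
lemma degree_switch (h : Switchable G X a b c e) (v : V) :
    (switch G a b c e).degree v = G.degree v := by
  have hadj := fun u => h.switch_adj (u := v) (v := u)
  obtain ⟨ha, hb, hc, he, hab, hce, hae, hcb⟩ := h
  have hab' := hab.ne
  have hce' := hce.ne
  have h1 : a ≠ e := by rintro rfl; exact he ha
  have h2 : c ≠ b := by rintro rfl; exact hc hb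
  have h3 : a ≠ c := by rintro rfl; exact hc ha
  have h4 : b ≠ e := by rintro rfl; exact he hb
  have key : ∀ x y : V, G.Adj v x → ¬G.Adj v y →
      (∀ u, (switch G a b c e).Adj v u ↔ (G.Adj v u ∧ u ≠ x) ∨ u = y) →
      (switch G a b c e).degree v = G.degree v := by
    intro x y hx hy hu
    have : (switch G a b c e).neighborFinset v = insert y ((G.neighborFinset v).erase x) := by
      ext u; simp [hu]; tauto
    rw [← SimpleGraph.card_neighborFinset_eq_degree, this, card_insert_of_notMem (by simp [hy]),
      card_erase_of_mem (by simpa using hx), SimpleGraph.card_neighborFinset_eq_degree]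
    have : 0 < G.degree v := (G.degree_pos_iff_exists_adj v).2 ⟨x, hx⟩
    omega
  simp only [Sym2.eq_iff, ne_eq] at hadj
  by_cases va : v = a
  · subst va; exact key b e hab hae (fun u => by rw [hadj]; grind)
  by_cases vb : v = b
  · subst vb; exact key a c hab.symm (fun h => hcb h.symm) (fun u => by rw [hadj]; grind)
  by_cases vc : v = c
  · subst vc; exact key e b hce hcb (fun u => by rw [hadj]; grind)
  by_cases ve : v = e
  · subst ve; exact key c a hce.symm (fun h => hae h.symm) (fun u => by rw [hadj]; grind)
  have : (switch G a b c e).neighborFinset v = G.neighborFinset v := by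
    ext u; simp [hadj, va, vb, vc, ve]
  rw [← SimpleGraph.card_neighborFinset_eq_degree, this, SimpleGraph.card_neighborFinset_eq_degree]

lemma card_crossPairs_switch_le (h : Switchable G X a b c e) :
    (crossPairs (switch G a b c e) X).card ≤ (crossPairs G X).card + 2 := by
  have : crossPairs (switch G a b c e) X ⊆ insert (a, e) (insert (b, c) (crossPairs G X)) := by
    rintro ⟨u, v⟩ hq
    have h' := h
    obtain ⟨ha, hb, hc, he, -⟩ := h
    simp only [mem_crossPairs, h'.switch_adj, Sym2.eq_iff] at hq
    simp only [mem_insert, mem_crossPairs, Prod.mk.injEq]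
    grind
  refine (card_le_card this).trans ((card_insert_le _ _).trans ?_)
  have := card_insert_le (b, c) (crossPairs G X)
  omega

/-- Admissibility prescribes the status of the four pairs involved, and all other pairs are
untouched. -/
lemma switch_injective {G' : SimpleGraph V} (h : Switchable G X a b c e)
    (h' : Switchable G' X a b c e) (hG : switch G a b c e = switch G' a b c e) : G = G' := by
  ext u v
  have h1 := h.switch_adj (u := u) (v := v)
  rw [hG, h'.switch_adj] at h1
  by_cases e1 : s(u, v) = s(a, b)
  · have : ∀ G : SimpleGraph V, G.Adj u v ↔ s(a, b) ∈ G.edgeSet := fun G => by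
      rw [← e1, SimpleGraph.mem_edgeSet]
    simp [this, h.hab, h'.hab]
  by_cases e2 : s(u, v) = s(c, e)
  · have : ∀ G : SimpleGraph V, G.Adj u v ↔ s(c, e) ∈ G.edgeSet := fun G => by
      rw [← e2, SimpleGraph.mem_edgeSet]
    simp [this, h.hce, h'.hce]
  by_cases e3 : s(u, v) = s(a, e)
  · have : ∀ G : SimpleGraph V, G.Adj u v ↔ s(a, e) ∈ G.edgeSet := fun G => by
      rw [← e3, SimpleGraph.mem_edgeSet]
    simp [this, h.hae, h'.hae]
  by_cases e4 : s(u, v) = s(c, b)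
  · have : ∀ G : SimpleGraph V, G.Adj u v ↔ s(c, b) ∈ G.edgeSet := fun G => by
      rw [← e4, SimpleGraph.mem_edgeSet]
    simp [this, h.hcb, h'.hcb]
  tauto

lemma switch_adj_left (h : Switchable G X a b c e) : (switch G a b c e).Adj a e := by
  rw [h.switch_adj]; tauto

lemma switch_adj_right (h : Switchable G X a b c e) : (switch G a b c e).Adj b c := by
  rw [SimpleGraph.adj_comm, h.switch_adj]; tauto

end Switchable

/-- The admissible switches of `G` whose pivots `a` and `c` lie in `S`, listed as
`((a, c), (b, e))`. -/
noncomputable def switches (G : SimpleGraph V) (S X : Finset V) : Finset ((V × V) × (V × V)) :=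
  univ.filter fun q => q.1.1 ∈ S ∧ q.1.2 ∈ S ∧ Switchable G X q.1.1 q.2.1 q.1.2 q.2.2

lemma mem_switches {G : SimpleGraph V} {S X : Finset V} {q : (V × V) × (V × V)} :
    q ∈ switches G S X ↔
      q.1.1 ∈ S ∧ q.1.2 ∈ S ∧ Switchable G X q.1.1 q.2.1 q.1.2 q.2.2 := by
  simp [switches]

/-- A graph with a sparse cut has many admissible switches. -/
lemma le_card_switches (G : SimpleGraph V) {S X : Finset V} {t d : ℝ} (hd : 0 < d) (ht0 : 0 ≤ t)
    (hS : ∀ v ∈ S, d ≤ G.degree v) (hA : t ≤ (S ∩ X).card) (hB : t ≤ (S \ X).card)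
    (hK : ((crossPairs G X).card : ℝ) ≤ t * d / 8) :
    t ^ 2 * d ^ 2 / 16 ≤ (switches G S X).card := by
  set A' := (S ∩ X).filter fun v => ((crossNeighbors G X v).card : ℝ) ≤ d / 4 with hA'
  set B' := (S \ X).filter fun v => ((crossNeighbors G X v).card : ℝ) ≤ d / 4 with hB'
  have cA : t / 2 ≤ A'.card :=
    half_le_card_filter_crossNeighbors G inter_subset_right hd hA hK
  have cB : t / 2 ≤ B'.card := by
    have := half_le_card_filter_crossNeighbors G (X := Xᶜ) (A := S \ X)
      (by intro v hv; simp at hv ⊢; exact hv.2) hd hB (by rwa [card_crossPairs_compl])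
    simpa only [crossNeighbors_compl] using this
  have sub : ((A' ×ˢ B').sigma fun q => privateNeighbors G X q.1 q.2 ×ˢ
      privateNeighbors G X q.2 q.1).card ≤ (switches G S X).card := by
    refine card_le_card_of_injOn (fun q => (q.1, q.2)) ?_ ?_
    · rintro ⟨⟨a, c⟩, ⟨b, e⟩⟩ h
      simp only [coe_sigma, Set.mem_sigma_iff, mem_coe, mem_product, hA', hB', mem_filter,
        mem_inter, Finset.mem_sdiff, mem_privateNeighbors] at h
      simp only [mem_coe, mem_switches]
      obtain ⟨⟨⟨⟨h1, h2⟩, -⟩, ⟨h3, h4⟩, -⟩, ⟨h5, h6, h7⟩, h8, h9, h10⟩ := h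
      exact ⟨h1, h3, ⟨h2, h6.1 h2, h4, fun h => h4 (h9.2 h), h5, h8, h10, h7⟩⟩
    · rintro ⟨a, b⟩ _ ⟨c, e⟩ _ h
      simpa using h
  rw [card_sigma] at sub
  have each : ∀ q ∈ A' ×ˢ B', d ^ 2 / 4 ≤
      ((privateNeighbors G X q.1 q.2 ×ˢ privateNeighbors G X q.2 q.1).card : ℝ) := by
    rintro ⟨a, c⟩ h
    simp only [mem_product, hA', hB', mem_filter, mem_inter, Finset.mem_sdiff] at h
    obtain ⟨⟨⟨h1, h2⟩, h3⟩, ⟨h4, h5⟩, h6⟩ := h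
    have e1 : (G.degree a : ℝ) ≤ (privateNeighbors G X a c).card + (crossNeighbors G X a).card
      + (crossNeighbors G X c).card := by
      exact_mod_cast degree_le_card_privateNeighbors G (X := X) (v := a) (u := c) (by tauto)
    have e2 : (G.degree c : ℝ) ≤ (privateNeighbors G X c a).card + (crossNeighbors G X c).card
      + (crossNeighbors G X a).card := by
      exact_mod_cast degree_le_card_privateNeighbors G (X := X) (v := c) (u := a) (by tauto)
    have d1 := hS a h1
    have d2 := hS c h4
    -- Degree at least `d`, minus at most `d / 4` cross neighbours of each of the two pivots.
    have f1 : d / 2 ≤ (privateNeighbors G X a c).card := by linarith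
    have f2 : d / 2 ≤ (privateNeighbors G X c a).card := by linarith
    rw [card_product]; push_cast
    calc d ^ 2 / 4 = (d / 2) * (d / 2) := by ring
      _ ≤ _ := mul_le_mul f1 f2 (by positivity) (by positivity)
  calc t ^ 2 * d ^ 2 / 16 = ((t / 2) * (t / 2)) * (d ^ 2 / 4) := by ring
    _ ≤ ((A'.card : ℝ) * B'.card) * (d ^ 2 / 4) := by gcongr
    _ = ∑ q ∈ A' ×ˢ B', d ^ 2 / 4 := by simp
    _ ≤ ∑ q ∈ A' ×ˢ B',
        ((privateNeighbors G X q.1 q.2 ×ˢ privateNeighbors G X q.2 q.1).card : ℝ) :=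
        sum_le_sum each
    _ ≤ _ := by exact_mod_cast sub

/-- The finite set of all realizations of `D`. -/
noncomputable def realizationsFinset (D : V → ℕ) : Finset (SimpleGraph V) :=
  univ.filter fun G => ∀ v, G.degree v = D v

lemma mem_realizationsFinset {D : V → ℕ} {G : SimpleGraph V} :
    G ∈ realizationsFinset D ↔ ∀ v, G.degree v = D v := by
  simp [realizationsFinset]

/-- The realizations of `D` with at most `K` edges across the cut given by `X`. -/
noncomputable def sparseCut (D : V → ℕ) (X : Finset V) (K : ℕ) : Finset (SimpleGraph V) :=
  univ.filter fun G => (∀ v, G.degree v = D v) ∧ (crossPairs G X).card ≤ K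

lemma mem_sparseCut {D : V → ℕ} {X : Finset V} {K : ℕ} {G : SimpleGraph V} :
    G ∈ sparseCut D X K ↔ (∀ v, G.degree v = D v) ∧ (crossPairs G X).card ≤ K := by
  simp [sparseCut]

/-- Double counting: a switch is recovered from its result and the two new crossing edges, and the
result has at most `K + 2` crossing edges, hence at most `(K + 2) ^ 2` ordered choices. -/
lemma sum_card_switches_le (D : V → ℕ) (S X : Finset V) (K : ℕ) :
    ∑ G ∈ sparseCut D X K, (switches G S X).card ≤
      (sparseCut D X (K + 2)).card * (K + 2) ^ 2 := by
  calc ∑ G ∈ sparseCut D X K, (switches G S X).card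
      = ((sparseCut D X K).sigma fun G => switches G S X).card := (card_sigma _ _).symm
    _ ≤ ((sparseCut D X (K + 2)).sigma fun G => crossPairs G X ×ˢ crossPairs G X).card := by
        refine card_le_card_of_injOn (fun q => ⟨switch q.1 q.2.1.1 q.2.2.1 q.2.1.2 q.2.2.2,
          ((q.2.1.1, q.2.2.2), (q.2.2.1, q.2.1.2))⟩) ?_ ?_
        · rintro ⟨G, ⟨a, c⟩, ⟨b, e⟩⟩ h
          simp only [coe_sigma, Set.mem_sigma_iff, mem_coe, mem_sparseCut, mem_switches] at h
          obtain ⟨⟨h1, h2⟩, -, -, h3⟩ := h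
          simp only [coe_sigma, Set.mem_sigma_iff, mem_coe, mem_sparseCut, mem_product,
            mem_crossPairs]
          exact ⟨⟨fun v => by rw [h3.degree_switch, h1],
            h3.card_crossPairs_switch_le.trans (by omega)⟩,
            ⟨h3.ha, h3.he, h3.switch_adj_left⟩, ⟨h3.hb, h3.hc, h3.switch_adj_right⟩⟩
        · rintro ⟨G, ⟨a, c⟩, ⟨b, e⟩⟩ h ⟨G', ⟨a', c'⟩, ⟨b', e'⟩⟩ h' hq
          simp only [coe_sigma, Set.mem_sigma_iff, mem_coe, mem_switches] at h h'
          simp only [Sigma.mk.injEq, heq_eq_eq, Prod.mk.injEq] at hq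
          obtain ⟨hq, ⟨rfl, rfl⟩, rfl, rfl⟩ := hq
          obtain rfl := h.2.2.2.switch_injective h'.2.2.2 hq
          rfl
    _ = ∑ G ∈ sparseCut D X (K + 2), (crossPairs G X).card ^ 2 := by
        rw [card_sigma]; simp [card_product, sq]
    _ ≤ ∑ G ∈ sparseCut D X (K + 2), (K + 2) ^ 2 :=
        sum_le_sum fun G hG => Nat.pow_le_pow_left (mem_sparseCut.1 hG).2 2
    _ = _ := by simp

lemma four_mul_card_sparseCut_le (D : V → ℕ) {S X : Finset V} {K : ℕ} {t d : ℝ} (hd : 0 < d)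
    (hS : ∀ v ∈ S, d ≤ D v) (hA : t ≤ (S ∩ X).card) (hB : t ≤ (S \ X).card)
    (hK : (K : ℝ) + 2 ≤ t * d / 8) :
    4 * (sparseCut D X K).card ≤ (sparseCut D X (K + 2)).card := by
  have htd : 0 < t * d := by have : (0 : ℝ) ≤ K := K.cast_nonneg; linarith
  have ht : 0 < t := pos_of_mul_pos_left htd hd.le
  have h1 : ((sparseCut D X K).card : ℝ) * (t ^ 2 * d ^ 2 / 16) ≤
      (sparseCut D X (K + 2)).card * (t ^ 2 * d ^ 2 / 64) := by
    calc ((sparseCut D X K).card : ℝ) * (t ^ 2 * d ^ 2 / 16)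
        = ∑ G ∈ sparseCut D X K, t ^ 2 * d ^ 2 / 16 := by simp
      _ ≤ ∑ G ∈ sparseCut D X K, ((switches G S X).card : ℝ) := by
          refine sum_le_sum fun G hG => ?_
          obtain ⟨hG1, hG2⟩ := mem_sparseCut.1 hG
          refine le_card_switches G hd ht.le (fun v hv => by rw [hG1]; exact hS v hv) hA hB ?_
          have : ((crossPairs G X).card : ℝ) ≤ K := by exact_mod_cast hG2
          linarith
      _ ≤ (sparseCut D X (K + 2)).card * ((K : ℝ) + 2) ^ 2 := by
          exact_mod_cast sum_card_switches_le D S X K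
      -- The backward count `t ^ 2 * d ^ 2 / 64` is a quarter of the forward count, whence the
      -- factor 4.
      _ ≤ (sparseCut D X (K + 2)).card * (t * d / 8) ^ 2 := by gcongr
      _ = _ := by ring
  have h2 : (4 * (sparseCut D X K).card : ℝ) * (t ^ 2 * d ^ 2 / 64) ≤
      (sparseCut D X (K + 2)).card * (t ^ 2 * d ^ 2 / 64) := by linarith
  exact_mod_cast le_of_mul_le_mul_right h2 (by positivity)

lemma four_pow_mul_card_sparseCut_le (D : V → ℕ) {S X : Finset V} {t d : ℝ} (hd : 0 < d)
    (hS : ∀ v ∈ S, d ≤ D v) (hA : t ≤ (S ∩ X).card) (hB : t ≤ (S \ X).card) (j K : ℕ)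
    (hK : (K : ℝ) + 2 * j ≤ t * d / 8) :
    4 ^ j * (sparseCut D X K).card ≤ (sparseCut D X (K + 2 * j)).card := by
  induction j with
  | zero => simp
  | succ j ih =>
    push_cast at hK
    have h1 := ih (by linarith)
    have h2 := four_mul_card_sparseCut_le D (K := K + 2 * j) hd hS hA hB
      (by push_cast; linarith)
    calc 4 ^ (j + 1) * (sparseCut D X K).card = 4 * (4 ^ j * (sparseCut D X K).card) := by ring
      _ ≤ 4 * (sparseCut D X (K + 2 * j)).card := by gcongr
      _ ≤ _ := h2

/-- Sparse cuts that separate two large sets of vertices of high degree are exponentially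
unlikely. -/
lemma card_sparseCut_le (D : V → ℕ) {S X : Finset V} {t d : ℝ} (hd : 0 < d) (ht : 0 ≤ t)
    (hS : ∀ v ∈ S, d ≤ D v) (hA : t ≤ (S ∩ X).card) (hB : t ≤ (S \ X).card) :
    ((sparseCut D X ⌊t * d / 16⌋₊).card : ℝ) ≤
      4 * (2 : ℝ) ^ (-(t * d / 16)) * (realizationsFinset D).card := by
  set K := ⌊t * d / 16⌋₊
  -- `K + 2 * j ≤ t * d / 8` is exactly the range of the factor-4 step. Rounding `j` down loses at
  -- most one factor 4, which is the constant in the bound.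
  set j := ⌊t * d / 32⌋₊
  have hK : (K : ℝ) ≤ t * d / 16 := Nat.floor_le (by positivity)
  have hj : (j : ℝ) ≤ t * d / 32 := Nat.floor_le (by positivity)
  have hj' : t * d / 32 < j + 1 := Nat.lt_floor_add_one _
  have h1 := four_pow_mul_card_sparseCut_le D hd hS hA hB j K (by linarith)
  have h2 : (sparseCut D X (K + 2 * j)).card ≤ (realizationsFinset D).card := by
    exact card_le_card fun G hG => mem_realizationsFinset.2 (mem_sparseCut.1 hG).1
  have h3 : (4 : ℝ) ^ j * (sparseCut D X K).card ≤ (realizationsFinset D).card := by exact_mod_cast h1.trans h2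
  have h4 : (1 : ℝ) ≤ 4 * (2 : ℝ) ^ (-(t * d / 16)) * 4 ^ j := by
    have e : (4 : ℝ) * (2 : ℝ) ^ (-(t * d / 16)) * 4 ^ j
        = (2 : ℝ) ^ (2 + -(t * d / 16) + 2 * j) := by
      rw [Real.rpow_add two_pos, Real.rpow_add two_pos, Real.rpow_mul two_pos.le]
      norm_num
    rw [e]
    exact Real.one_le_rpow one_le_two (by linarith)
  calc ((sparseCut D X K).card : ℝ) ≤ (4 * (2 : ℝ) ^ (-(t * d / 16)) * 4 ^ j) *
        (sparseCut D X K).card := le_mul_of_one_le_left (by positivity) h4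
    _ = 4 * (2 : ℝ) ^ (-(t * d / 16)) * (4 ^ j * (sparseCut D X K).card) := by ring
    _ ≤ _ := by gcongr

end Switching

/-! ### Deterministic facts about components. -/

section Components

open Classical Finset

variable {V : Type*} [Fintype V] [DecidableEq V]

/-- If no component contains almost all of `S`, then some cut without crossing edges splits `S`
into two parts of positive proportion. -/
lemma exists_balanced_cut (H : SimpleGraph V) {S : Finset V} {ε : ℝ} (hε : 0 < ε)
    (hε' : ε ≤ 1 / 2) (hS : 0 < S.card)
    (h : ∀ c : H.ConnectedComponent, ((↑S ∩ c.supp).ncard : ℝ) < (1 - ε) * S.card) :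
    ∃ X : Finset V, crossPairs H X = ∅ ∧ ε * S.card / 2 ≤ (S ∩ X).card ∧
      ε * S.card / 2 ≤ (S \ X).card := by
  have hs : (0 : ℝ) < S.card := by exact_mod_cast hS
  have hpos : 0 < ε * S.card := by positivity
  -- A smallest union of components with enough of `S`; the whole vertex set is a candidate.
  obtain ⟨X, hX, hmin⟩ := exists_min_image (univ.filter fun X : Finset V =>
    crossPairs H X = ∅ ∧ ε * S.card / 2 ≤ ((S ∩ X).card : ℝ)) card
    ⟨univ, by
      simp only [mem_filter, mem_univ, true_and, inter_univ]
      refine ⟨by ext; simp [mem_crossPairs], by nlinarith⟩⟩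
  simp only [mem_filter, mem_univ, true_and] at hX hmin
  obtain ⟨hX1, hX2⟩ := hX
  refine ⟨X, hX1, hX2, ?_⟩
  have hclosed : ∀ u v, H.Adj u v → u ∈ X → v ∈ X := by
    intro u v huv hu
    by_contra hv
    have : (u, v) ∈ crossPairs H X := mem_crossPairs.2 ⟨hu, hv, huv⟩
    rw [hX1] at this; simp at this
  have hne : X.Nonempty := by
    by_contra hne
    rw [not_nonempty_iff_eq_empty] at hne
    subst hne
    simp at hX2
    linarith
  obtain ⟨v, hv⟩ := hne
  set c := H.connectedComponentMk v
  set C : Finset V := univ.filter (· ∈ c.supp) with hC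
  have hCX : C ⊆ X := by
    intro w hw
    simp only [hC, mem_filter, mem_univ, true_and] at hw
    have hwalk : ∀ a b, H.Walk a b → a ∈ X → b ∈ X := by
      intro a b q
      induction q with
      | nil => exact id
      | cons hadj _ ih => exact fun ha => ih (hclosed _ _ hadj ha)
    obtain ⟨q⟩ := (SimpleGraph.ConnectedComponent.exact hw).symm
    exact hwalk _ _ q hv
  have hvC : v ∈ C := by simp [hC, c]
  have hCclosed : ∀ u w, H.Adj u w → (u ∈ C ↔ w ∈ C) := by
    intro u w huw
    simp only [hC, mem_filter, mem_univ, true_and, SimpleGraph.ConnectedComponent.mem_supp_iff]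
    rw [SimpleGraph.ConnectedComponent.sound huw.reachable]
  have hSC : ((S ∩ C).card : ℝ) < (1 - ε) * S.card := by
    have : (↑S ∩ c.supp : Set V) = ↑(S ∩ C) := by ext; simp [hC]
    have hc := h c
    rwa [this, Set.ncard_coe_finset] at hc
  have hsplit : ((S ∩ X).card : ℝ) + (S \ X).card = S.card := by
    exact_mod_cast card_inter_add_card_sdiff S X
  -- If `X` is one component, the hypothesis leaves more than `ε * |S|` of `S` outside. Otherwise
  -- `C` and `X \ C` are smaller unions of components, so by minimality `X` has less than `ε * |S|`
  -- of `S`, and `ε ≤ 1 / 2` finishes.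
  by_cases hCeq : C = X
  · rw [hCeq] at hSC; linarith
  have hss : C ⊂ X := hCX.ssubset_of_ne hCeq
  have b1 : ((S ∩ C).card : ℝ) < ε * S.card / 2 := by
    by_contra hcon
    have := hmin C ⟨by ext ⟨u, w⟩; simp [mem_crossPairs]; grind, not_lt.1 hcon⟩
    exact absurd (card_lt_card hss) (by omega)
  have b2 : ((S ∩ (X \ C)).card : ℝ) < ε * S.card / 2 := by
    by_contra hcon
    have := hmin (X \ C) ⟨by ext ⟨u, w⟩; simp [mem_crossPairs]; grind, not_lt.1 hcon⟩
    have h2 := card_sdiff_add_card_eq_card hCX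
    have h3 : 0 < C.card := card_pos.2 ⟨v, hvC⟩
    omega
  have b3 : ((S ∩ X).card : ℝ) ≤ (S ∩ C).card + (S ∩ (X \ C)).card := by
    have : S ∩ X ⊆ (S ∩ C) ∪ (S ∩ (X \ C)) := by intro x; simp; tauto
    exact_mod_cast (card_le_card this).trans (card_union_le _ _)
  nlinarith

/-- The vertices outside `S` that have a neighbour in `H`. -/
noncomputable def nonIsolatedOutside (H : SimpleGraph V) (S : Finset V) : Finset V :=
  Sᶜ.filter fun v => ∃ w, H.Adj v w

/-- A component is a single vertex or consists of vertices that are not isolated. -/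
lemma largestComponent_le (H : SimpleGraph V) (S : Finset V) :
    largestComponent H ≤ 1 + S.card + (nonIsolatedOutside H S).card := by
  refine ciSup_le' fun c => ?_
  by_cases hc : c.supp.Subsingleton
  · have := Set.ncard_le_one_iff_subsingleton.2 hc
    omega
  have hsub : c.supp ⊆ ↑(S ∪ nonIsolatedOutside H S) := by
    intro v hv
    obtain ⟨w, hw, hwv⟩ := (Set.not_subsingleton_iff.1 hc).exists_ne v
    have hr : H.Reachable v w := SimpleGraph.ConnectedComponent.exact
      (((SimpleGraph.ConnectedComponent.mem_supp_iff _ _).1 hv).trans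
        ((SimpleGraph.ConnectedComponent.mem_supp_iff _ _).1 hw).symm)
    obtain ⟨q⟩ := hr
    have : ∃ u, H.Adj v u := by
      cases q with
      | nil => exact absurd rfl hwv
      | cons h _ => exact ⟨_, h⟩
    by_cases hvS : v ∈ S <;> simp [nonIsolatedOutside, hvS, this]
  have := Set.ncard_le_ncard hsub (finite_toSet _)
  rw [Set.ncard_coe_finset] at this
  have := card_union_le S (nonIsolatedOutside H S)
  omega

end Components

end DegreePercolation

namespace DegreePercolation

set_option linter.unusedSectionVars false

/-! ### Probability bounds for the percolated random graph. -/

section Law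

open Classical Finset unitInterval

/-- There are finitely many graphs on `V`, so this makes every event measurable. -/
instance {V : Type*} [Finite V] : MeasurableSingletonClass (SimpleGraph V) where
  measurableSet_singleton G := by
    have : ({G} : Set (SimpleGraph V)) = SimpleGraph.edgeSet ⁻¹' {G.edgeSet} := by
      ext H; simp
    rw [this]
    exact SimpleGraph.measurable_edgeSet (measurableSet_singleton _)

instance {V : Type*} (G : SimpleGraph V) (p : I) : IsProbabilityMeasure (percolation G p) :=
  Measure.isProbabilityMeasure_map (by fun_prop)

variable {V : Type*} [Fintype V] [DecidableEq V]

/-- The event is a cylinder of the product measure; edges of `G` are not loops, so `fromEdgeSet`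
does not affect them. -/
lemma percolation_forall_notMem (G : SimpleGraph V) (p : I) (F : Finset (Sym2 V))
    (hF : (F : Set (Sym2 V)) ⊆ G.edgeSet) :
    percolation G p {H | ∀ e ∈ F, e ∉ H.edgeSet} = ENNReal.ofReal (1 - p) ^ F.card := by
  rw [percolation, Measure.map_apply (by fun_prop) (Set.toFinite _).measurableSet,
    setBernoulli_apply']
  have : ((fun q : Sym2 V → Prop => {e | q e}) ⁻¹' (SimpleGraph.fromEdgeSet ⁻¹'
      {H : SimpleGraph V | ∀ e ∈ F, e ∉ H.edgeSet})) = Set.pi F fun _ => {False} := by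
    ext q
    simp only [Set.mem_preimage, Set.mem_ofPred_eq, SimpleGraph.edgeSet_fromEdgeSet, Set.mem_sdiff,
      Set.mem_pi, mem_coe, Set.mem_singleton_iff, eq_iff_iff, iff_false]
    refine forall₂_congr fun e he => ?_
    have := G.not_isDiag_of_mem_edgeSet (hF he)
    simp [this]
  rw [this, Measure.infinitePi_pi _ (fun _ _ => measurableSet_singleton _), ← prod_const]
  refine prod_congr rfl fun e he => ?_
  have he' : e ∈ G.edgeSet := hF he
  have : ((toNNReal (σ p) : NNReal) : ENNReal) = ENNReal.ofReal (1 - p) := by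
    rw [← coe_symm_eq, ← coe_toNNReal, ENNReal.ofReal_coe_nnreal]
  simp [he', this]

lemma percolation_adj_le (G : SimpleGraph V) (p : I) (v : V) :
    percolation G p {H | ∃ w, H.Adj v w} ≤ G.degree v * ENNReal.ofReal p := by
  have hone : ∀ w ∈ G.neighborFinset v, percolation G p {H | H.Adj v w} ≤ ENNReal.ofReal p := by
    intro w hw
    rw [SimpleGraph.mem_neighborFinset] at hw
    have h := percolation_forall_notMem G p {s(v, w)} (by simpa using hw)
    have hc : {H : SimpleGraph V | H.Adj v w} =
        {H | ∀ e ∈ ({s(v, w)} : Finset (Sym2 V)), e ∉ H.edgeSet}ᶜ := by ext; simp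
    rw [hc, prob_compl_eq_one_sub (Set.toFinite _).measurableSet, h, card_singleton, pow_one,
      ← ENNReal.ofReal_one, ← ENNReal.ofReal_sub _ (by have := p.2.2; linarith)]
    simp
  -- Almost surely only neighbours in `G` matter, which limits the union bound to `G.degree v`
  -- terms.
  have hae : ∀ᵐ H ∂percolation G p, H ≤ G := by
    rw [percolation, ae_map_iff (by fun_prop) (Set.toFinite _).measurableSet]
    filter_upwards [setBernoulli_ae_subset] with s hs
    intro a b hab
    exact hs ((SimpleGraph.fromEdgeSet_adj s).1 hab).1
  calc percolation G p {H | ∃ w, H.Adj v w}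
      ≤ percolation G p (⋃ w ∈ G.neighborFinset v, {H | H.Adj v w}) := by
        refine measure_mono_ae ?_
        filter_upwards [hae] with H hH
        rintro ⟨w, hw⟩
        exact Set.mem_biUnion (by simpa using hH hw) hw
    _ ≤ ∑ w ∈ G.neighborFinset v, percolation G p {H | H.Adj v w} :=
        measure_biUnion_finset_le _ _
    _ ≤ ∑ w ∈ G.neighborFinset v, ENNReal.ofReal p := sum_le_sum hone
    _ = _ := by simp

lemma percolation_crossPairs_eq_empty (G : SimpleGraph V) (p : I) (X : Finset V) :
    percolation G p {H | crossPairs H X = ∅} ≤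
      ENNReal.ofReal ((1 - p) ^ (crossPairs G X).card) := by
  set F := (crossPairs G X).image fun q => s(q.1, q.2) with hF
  have hcard : F.card = (crossPairs G X).card := by
    refine card_image_of_injOn ?_
    rintro ⟨a, b⟩ h ⟨c, e⟩ h' hq
    simp only [mem_coe, mem_crossPairs] at h h'
    simp only [Sym2.eq_iff] at hq
    grind
  rw [ENNReal.ofReal_pow (by have := p.2.2; linarith), ← hcard,
    ← percolation_forall_notMem G p F]
  · refine measure_mono fun H hH => ?_
    simp only [Set.mem_ofPred_eq] at hH
    simp only [Set.mem_ofPred_eq, hF, mem_image, forall_exists_index, and_imp]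
    rintro _ ⟨a, b⟩ hq rfl hadj
    have : (a, b) ∈ crossPairs H X := by
      rw [mem_crossPairs] at hq ⊢
      exact ⟨hq.1, hq.2.1, hadj⟩
    simp [hH] at this
  · intro e he
    simp only [hF, coe_image, Set.mem_image, mem_coe, mem_crossPairs] at he
    obtain ⟨q, hq, rfl⟩ := he
    exact hq.2.2

variable {n : ℕ} {D : Fin n → ℕ}

lemma percolatedLaw_apply (D : Fin n → ℕ) (p : I) (B : Set (SimpleGraph (Fin n))) :
    percolatedLaw D p B = ∫⁻ G, percolation G p B ∂uniformOn (realizations D) :=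
  Measure.bind_apply (Set.toFinite _).measurableSet (Measurable.of_discrete).aemeasurable

lemma isProbabilityMeasure_uniformOn_realizations (hD : Feasible D) :
    IsProbabilityMeasure (uniformOn (realizations D)) :=
  isProbabilityMeasure_uniformOn (Set.toFinite _) hD

lemma isProbabilityMeasure_percolatedLaw (hD : Feasible D) (p : I) :
    IsProbabilityMeasure (percolatedLaw D p) := by
  have := isProbabilityMeasure_uniformOn_realizations hD
  exact ⟨by simp [percolatedLaw_apply]⟩

lemma ae_uniformOn_realizations (D : Fin n → ℕ) :
    ∀ᵐ G ∂uniformOn (realizations D), G ∈ realizations D :=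
  ae_cond_mem (Set.toFinite _).measurableSet

lemma uniformOn_sparseCut (D : Fin n → ℕ) (X : Finset (Fin n)) (K : ℕ) :
    uniformOn (realizations D) ↑(sparseCut D X K) = (sparseCut D X K).card /
      (realizationsFinset D).card := by
  have h : realizations D = ↑(realizationsFinset D) := by
    ext; simp [realizations, mem_realizationsFinset]
  rw [h, uniformOn_apply_finset, inter_eq_right.2]
  intro G hG
  exact mem_realizationsFinset.2 (mem_sparseCut.1 hG).1

/-- Split by whether the cut is sparse before percolation: the sparse case contributes the 4 in `5 =
4 + 1`, using `p ≤ 1`, and the other case the 1. -/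
lemma percolatedLaw_crossPairs_eq_empty_le (hD : Feasible D) (p : I) {S X : Finset (Fin n)}
    {t d : ℝ} (hd : 0 < d) (ht : 0 ≤ t) (hS : ∀ v ∈ S, d ≤ D v) (hA : t ≤ (S ∩ X).card)
    (hB : t ≤ (S \ X).card) :
    percolatedLaw D p {H | crossPairs H X = ∅} ≤
      ENNReal.ofReal (5 * (2 : ℝ) ^ (-(p * (t * d) / 16))) := by
  have hp0 := p.2.1
  have hp1 := p.2.2
  have htd : 0 ≤ t * d := by positivity
  have := isProbabilityMeasure_uniformOn_realizations hD
  set K := ⌊t * d / 16⌋₊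
  set c := (2 : ℝ) ^ (-(p * (t * d) / 16)) with hc
  have hc0 : 0 < c := by positivity
  have h1 : ∀ᵐ G ∂uniformOn (realizations D), percolation G p {H | crossPairs H X = ∅} ≤
      Set.indicator ↑(sparseCut D X K) 1 G + ENNReal.ofReal c := by
    filter_upwards [ae_uniformOn_realizations D] with G hG
    by_cases hGK : G ∈ sparseCut D X K
    · rw [Set.indicator_of_mem (by exact_mod_cast hGK)]
      exact prob_le_one.trans le_self_add
    · rw [Set.indicator_of_notMem (by exact_mod_cast hGK), zero_add]
      refine (percolation_crossPairs_eq_empty G p X).trans (ENNReal.ofReal_le_ofReal ?_)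
      have hK : t * d / 16 ≤ (crossPairs G X).card := by
        have : K < (crossPairs G X).card := by
          by_contra hcon
          exact hGK (mem_sparseCut.2 ⟨by simpa [realizations] using hG, not_lt.1 hcon⟩)
        have h2 : t * d / 16 < K + 1 := Nat.lt_floor_add_one _
        have h3 : (K : ℝ) + 1 ≤ (crossPairs G X).card := by exact_mod_cast this
        linarith
      calc (1 - (p : ℝ)) ^ (crossPairs G X).card
          ≤ (Real.exp (-p)) ^ (crossPairs G X).card := by
            refine pow_le_pow_left₀ (by linarith) ?_ _
            have := Real.add_one_le_exp (-(p : ℝ))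
            linarith
        _ = Real.exp (-(p * (crossPairs G X).card)) := by
            rw [← Real.exp_nat_mul]; ring_nf
        _ ≤ Real.exp (-(p * (t * d / 16))) := by gcongr
        _ ≤ c := by
            rw [hc, Real.rpow_def_of_pos two_pos]
            gcongr
            have := Real.log_two_lt_d9
            have h3 : 0 ≤ p * (t * d / 16) := by positivity
            nlinarith
  have h2 : uniformOn (realizations D) ↑(sparseCut D X K) ≤ ENNReal.ofReal (4 * c) := by
    rw [uniformOn_sparseCut]
    refine ENNReal.div_le_of_le_mul ?_
    rw [← ENNReal.ofReal_natCast, ← ENNReal.ofReal_natCast (realizationsFinset D).card,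
      ← ENNReal.ofReal_mul (by positivity)]
    refine ENNReal.ofReal_le_ofReal ((card_sparseCut_le D hd ht hS hA hB).trans ?_)
    gcongr 4 * ?_ * _
    refine Real.rpow_le_rpow_of_exponent_le one_le_two ?_
    nlinarith
  calc percolatedLaw D p {H | crossPairs H X = ∅}
      = ∫⁻ G, percolation G p {H | crossPairs H X = ∅} ∂uniformOn (realizations D) :=
        percolatedLaw_apply D p _
    _ ≤ ∫⁻ G, (Set.indicator ↑(sparseCut D X K) 1 G + ENNReal.ofReal c)
          ∂uniformOn (realizations D) := lintegral_mono_ae h1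
    _ = uniformOn (realizations D) ↑(sparseCut D X K) + ENNReal.ofReal c := by
        rw [lintegral_add_right _ measurable_const,
          lintegral_indicator_one (Set.toFinite _).measurableSet]
        simp
    _ ≤ ENNReal.ofReal (4 * c) + ENNReal.ofReal c := by gcongr
    _ = _ := by rw [← ENNReal.ofReal_add (by positivity) (by positivity)]; ring_nf

/-- With high probability some component contains almost all vertices of high degree. -/
lemma percolatedLaw_no_large_component_le (hD : Feasible D) (p : I) {S : Finset (Fin n)}
    {ε d : ℝ} (hd : 0 < d) (hε : 0 < ε) (hε' : ε ≤ 1 / 2) (hS0 : 0 < S.card)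
    (hS : ∀ v ∈ S, d ≤ D v) :
    percolatedLaw D p {H | ∀ c : H.ConnectedComponent,
        ((↑S ∩ c.supp).ncard : ℝ) < (1 - ε) * S.card} ≤
      ENNReal.ofReal (5 * (2 : ℝ) ^ ((n : ℝ) - p * (ε * S.card * d) / 32)) := by
  set T := univ.filter fun X : Finset (Fin n) =>
    ε * S.card / 2 ≤ ((S ∩ X).card : ℝ) ∧ ε * S.card / 2 ≤ ((S \ X).card : ℝ)
  set c := 5 * (2 : ℝ) ^ (-(p * ((ε * S.card / 2) * d) / 16)) with hc
  have hT : (T.card : ℝ) ≤ 2 ^ n := by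
    have := card_le_card (subset_univ T)
    rw [card_univ, Fintype.card_finset, Fintype.card_fin] at this
    exact_mod_cast this
  calc _ ≤ percolatedLaw D p (⋃ X ∈ T, {H | crossPairs H X = ∅}) := by
        refine measure_mono fun H hH => ?_
        obtain ⟨X, h1, h2, h3⟩ := exists_balanced_cut H hε hε' hS0 hH
        simp only [Set.mem_iUnion]
        exact ⟨X, by simp [T, h2, h3], h1⟩
    _ ≤ ∑ X ∈ T, percolatedLaw D p {H | crossPairs H X = ∅} := measure_biUnion_finset_le _ _
    _ ≤ ∑ X ∈ T, ENNReal.ofReal c := by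
        refine sum_le_sum fun X hX => ?_
        obtain ⟨h2, h3⟩ : ε * S.card / 2 ≤ ((S ∩ X).card : ℝ) ∧
          ε * S.card / 2 ≤ ((S \ X).card : ℝ) := by simpa [T] using hX
        exact percolatedLaw_crossPairs_eq_empty_le hD p hd (by positivity) hS h2 h3
    _ = ENNReal.ofReal (T.card * c) := by
        rw [sum_const, nsmul_eq_mul, ENNReal.ofReal_mul (p := (T.card : ℝ)) (Nat.cast_nonneg _),
          ENNReal.ofReal_natCast]
    _ ≤ ENNReal.ofReal (2 ^ n * c) := by gcongr
    _ = _ := by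
        rw [hc, sub_eq_add_neg, Real.rpow_add two_pos, Real.rpow_natCast]
        ring_nf

/-- Few vertices of low degree are not isolated after percolation. -/
lemma percolatedLaw_card_adj_le (hD : Feasible D) (p : I) {S : Finset (Fin n)} {d a : ℝ}
    (hS : ∀ v ∉ S, (D v : ℝ) ≤ d) (ha : 0 < a) :
    percolatedLaw D p {H | a ≤ ((nonIsolatedOutside H S).card : ℝ)} ≤
      ENNReal.ofReal (n * (d * p) / a) := by
  have hp0 := p.2.1
  have := isProbabilityMeasure_uniformOn_realizations hD
  have hv : ∀ v ∉ S, percolatedLaw D p {H | ∃ w, H.Adj v w} ≤ ENNReal.ofReal (d * p) := by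
    intro v hv
    rw [percolatedLaw_apply]
    calc _ ≤ ∫⁻ _, ENNReal.ofReal (d * p) ∂uniformOn (realizations D) := by
          refine lintegral_mono_ae ?_
          filter_upwards [ae_uniformOn_realizations D] with G hG
          refine (percolation_adj_le G p v).trans ?_
          have hG' : ∀ v, G.degree v = D v := by simpa [realizations] using hG
          rw [hG', ← ENNReal.ofReal_natCast, ← ENNReal.ofReal_mul (by positivity)]
          exact ENNReal.ofReal_le_ofReal (mul_le_mul_of_nonneg_right (hS v hv) hp0)
      _ = _ := by simp
  have hset : {H : SimpleGraph (Fin n) |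
      a ≤ ((nonIsolatedOutside H S).card : ℝ)} =
      {H | ENNReal.ofReal a ≤ ∑ v ∈ Sᶜ, Set.indicator {H | ∃ w, H.Adj v w} 1 H} := by
    ext H
    have : (∑ v ∈ Sᶜ, Set.indicator {H : SimpleGraph (Fin n) | ∃ w, H.Adj v w} 1 H : ENNReal) =
        ENNReal.ofReal ((nonIsolatedOutside H S).card : ℝ) := by
      rw [ENNReal.ofReal_natCast, nonIsolatedOutside, card_filter]
      push_cast
      exact sum_congr rfl fun v _ => by simp [Set.indicator_apply]
    simp only [Set.mem_ofPred_eq, this]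
    rw [ENNReal.ofReal_le_ofReal_iff (by positivity)]
  rw [hset]
  -- Markov's inequality; the expectation is then computed by linearity.
  refine (meas_ge_le_lintegral_div (Measurable.of_discrete).aemeasurable (by simpa using ha)
    ENNReal.ofReal_ne_top).trans ?_
  rw [ENNReal.ofReal_div_of_pos ha]
  gcongr
  rw [lintegral_finsetSum _ (fun _ _ => Measurable.of_discrete)]
  calc _ = ∑ v ∈ Sᶜ, percolatedLaw D p {H | ∃ w, H.Adj v w} := by
        refine sum_congr rfl fun v _ => ?_
        rw [lintegral_indicator_one (Set.toFinite _).measurableSet]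
    _ ≤ ∑ v ∈ Sᶜ, ENNReal.ofReal (d * p) := sum_le_sum fun v h => hv v (by simpa using h)
    _ ≤ ∑ v : Fin n, ENNReal.ofReal (d * p) := sum_le_sum_of_subset (subset_univ _)
    _ = _ := by
        rw [sum_const, card_univ, Fintype.card_fin, nsmul_eq_mul,
          ENNReal.ofReal_mul (p := (n : ℝ)) n.cast_nonneg, ENNReal.ofReal_natCast]

end Law

end DegreePercolation

namespace DegreePercolation

/-! ### Choice of the error terms and passage to the limit. -/

section Asymptotics

open unitInterval

variable {Ω : ℕ → Type*} [∀ n, MeasurableSpace (Ω n)] {μ : ∀ n, Measure (Ω n)}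

lemma AAS.mono {A B : ∀ n, Set (Ω n)} (hμ : ∀ n, IsProbabilityMeasure (μ n)) (hA : AAS μ A)
    (h : ∀ n, A n ⊆ B n) : AAS μ B :=
  tendsto_of_tendsto_of_tendsto_of_le_of_le hA tendsto_const_nhds
    (fun n => measure_mono (h n)) (fun _ => prob_le_one)

lemma aas_of_measure_compl_le {A : ∀ n, Set (Ω n)} (hμ : ∀ n, IsProbabilityMeasure (μ n))
    (hA : ∀ n, MeasurableSet (A n)) {g : ℕ → ℝ} (hg : Tendsto g atTop (𝓝 0))
    (h : ∀ᶠ n in atTop, μ n (A n)ᶜ ≤ ENNReal.ofReal (g n)) : AAS μ A := by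
  have h0 : Tendsto (fun n => ENNReal.ofReal (g n)) atTop (𝓝 0) := by
    simpa using ENNReal.tendsto_ofReal hg
  have h1 : Tendsto (fun n => 1 - ENNReal.ofReal (g n)) atTop (𝓝 1) := by
    simpa using ENNReal.Tendsto.sub tendsto_const_nhds h0 (Or.inl ENNReal.one_ne_top)
  refine tendsto_of_tendsto_of_tendsto_of_le_of_le' h1 tendsto_const_nhds ?_
    (.of_forall fun _ => prob_le_one)
  filter_upwards [h] with n hn
  rw [tsub_le_iff_right, ← prob_add_prob_compl (μ := μ n) (hA n)]
  gcongr

lemma ncard_supp_le_largestComponent {V : Type*} [Finite V] (H : SimpleGraph V)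
    (c : H.ConnectedComponent) : c.supp.ncard ≤ largestComponent H :=
  le_ciSup (f := fun c : H.ConnectedComponent => c.supp.ncard) (Set.finite_range _).bddAbove c

lemma mem_highDegree {n : ℕ} {D : Fin n → ℕ} {d : ℝ} {v : Fin n} :
    v ∈ highDegree D d ↔ d ≤ D v := Iff.rfl

lemma natCast_mul_isLittleO {u : ℕ → ℝ} (hu : Tendsto u atTop (𝓝 0)) :
    (fun n : ℕ => (n : ℝ) * u n) =o[atTop] fun n : ℕ => (n : ℝ) := by
  simpa using (Asymptotics.isBigO_refl (fun n : ℕ => (n : ℝ)) atTop).mul_isLittleO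
    ((Asymptotics.isLittleO_one_iff ℝ).2 hu)

lemma const_isLittleO_natCast (c : ℝ) :
    (fun _ : ℕ => c) =o[atTop] fun n : ℕ => (n : ℝ) :=
  (Asymptotics.isLittleO_const_id_atTop c).comp_tendsto tendsto_natCast_atTop_atTop

variable {D : ∀ n : ℕ, Fin n → ℕ} {d : ℕ → ℝ} {δ : ℝ} {p : ℕ → I}

theorem largestComponent_le_of_subcritical (hD : ∀ n, Feasible (D n)) (hd : ∀ n, 0 < d n)
    (hS : (fun n : ℕ => ((highDegree (D n) (d n)).ncard : ℝ) - δ * n)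
      =o[atTop] fun n : ℕ => (n : ℝ))
    (hp : (fun n => (p n : ℝ)) =o[atTop] (fun n => 1 / d n)) :
    ∃ f : ℕ → ℝ, f =o[atTop] (fun n : ℕ => (n : ℝ)) ∧
      AAS (fun n => percolatedLaw (D n) (p n))
        (fun n => {H | (largestComponent H : ℝ) ≤ δ * n + f n}) := by
  classical
  have hω : Tendsto (fun n => d n * p n) atTop (𝓝 0) := by
    refine hp.tendsto_div_nhds_zero.congr fun n => ?_
    have := (hd n).ne'
    field_simp
  have hsqrt : Tendsto (fun n => √(d n * p n)) atTop (𝓝 0) := by simpa using hω.sqrt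
  -- The 2 covers the 1 for singleton components and the 1 in the Markov threshold `1 + n * r`,
  -- which keeps that threshold positive even when `n * r = 0`.
  refine ⟨fun n => 2 + (((highDegree (D n) (d n)).ncard : ℝ) - δ * n) + n * √(d n * p n),
    ((const_isLittleO_natCast 2).add hS).add (natCast_mul_isLittleO hsqrt), ?_⟩
  refine aas_of_measure_compl_le (fun n => isProbabilityMeasure_percolatedLaw (hD n) (p n))
    (fun n => (Set.toFinite _).measurableSet) hsqrt (.of_forall fun n => ?_)
  set S : Finset (Fin n) := (highDegree (D n) (d n)).toFinset 
  set r := √(d n * p n) with hr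
  have hr0 : 0 ≤ r := Real.sqrt_nonneg _
  have hr2 : d n * p n = r * r :=
    (Real.mul_self_sqrt (mul_nonneg (hd n).le (p n).2.1)).symm
  have hcard : (highDegree (D n) (d n)).ncard = S.card := Set.ncard_eq_toFinset_card' _
  have ha : 0 < 1 + n * r := by positivity
  have hlow : ∀ v ∉ S, (D n v : ℝ) ≤ d n := by
    intro v hv
    exact (not_le.1 fun h => hv (Set.mem_toFinset.2 (mem_highDegree.2 h))).le
  calc _ ≤ percolatedLaw (D n) (p n)
        {H | 1 + n * r ≤ ((nonIsolatedOutside H S).card : ℝ)} := by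
        refine measure_mono fun H hH => ?_
        simp only [Set.mem_compl_iff, Set.mem_ofPred_eq, not_le, hcard] at hH ⊢
        have : (largestComponent H : ℝ) ≤ 1 + S.card + (nonIsolatedOutside H S).card := by
          exact_mod_cast largestComponent_le H S
        linarith
    _ ≤ _ := percolatedLaw_card_adj_le (hD n) (p n) hlow ha
    _ ≤ _ := by
        refine ENNReal.ofReal_le_ofReal ?_
        -- `n * r ^ 2 / (1 + n * r) ≤ r`.
        rw [div_le_iff₀ ha, hr2]
        nlinarith

theorem exists_component_of_supercritical (hD : ∀ n, Feasible (D n)) (hd : ∀ n, 0 < d n)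
    (hδ : 0 < δ)
    (hS : (fun n : ℕ => ((highDegree (D n) (d n)).ncard : ℝ) - δ * n)
      =o[atTop] fun n : ℕ => (n : ℝ))
    (hp : (fun n => 1 / d n) =o[atTop] (fun n => (p n : ℝ))) :
    ∃ ε : ℕ → ℝ, Tendsto ε atTop (𝓝 0) ∧
      AAS (fun n => percolatedLaw (D n) (p n))
        (fun n => {H | ∃ c : H.ConnectedComponent,
          (1 - ε n) * ((highDegree (D n) (d n)).ncard : ℝ) ≤
            ((highDegree (D n) (d n) ∩ c.supp).ncard : ℝ)}) := by
  classical
  have hω : Tendsto (fun n => d n * p n) atTop atTop := by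
    refine tendsto_atTop.2 fun b => ?_
    -- The maximum makes the little-o constant positive for every `b`.
    have hb : 0 < max b 1 := by positivity
    filter_upwards [hp.def (inv_pos.2 hb)] with n hn
    rw [Real.norm_of_nonneg (one_div_pos.2 (hd n)).le, Real.norm_of_nonneg (p n).2.1,
      div_le_iff₀ (hd n)] at hn
    have : max b 1 * 1 ≤ max b 1 * ((max b 1)⁻¹ * p n * d n) := by gcongr
    rw [mul_one, ← mul_assoc, ← mul_assoc, mul_inv_cancel₀ hb.ne', one_mul, mul_comm] at this
    exact (le_max_left _ _).trans this
  have hsqrt : Tendsto (fun n => √(d n * p n)) atTop atTop := Real.tendsto_sqrt_atTop.comp hω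
  refine ⟨fun n => (√(d n * p n))⁻¹, hsqrt.inv_tendsto_atTop, ?_⟩
  have hg : Tendsto (fun n : ℕ => 5 * (1 / 2 : ℝ) ^ n) atTop (𝓝 0) := by
    simpa using (tendsto_pow_atTop_nhds_zero_of_lt_one (by norm_num : (0 : ℝ) ≤ 1 / 2)
      (by norm_num)).const_mul 5
  refine aas_of_measure_compl_le (fun n => isProbabilityMeasure_percolatedLaw (hD n) (p n))
    (fun n => (Set.toFinite _).measurableSet) hg ?_
  -- With `r = √(d * p)`: `r ≥ 2` gives `ε = 1 / r ≤ 1 / 2`; `r ≥ 128 / δ` and `|S| ≥ δ * n / 2`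
  -- give `r * |S| / 32 ≥ 2 * n`, so the exponent is at most `-n`.
  filter_upwards [hS.def (half_pos hδ), hsqrt.eventually_ge_atTop 2,
    hsqrt.eventually_ge_atTop (128 / δ), eventually_ge_atTop 1] with n h1 h2 h3 hn
  set S : Finset (Fin n) := (highDegree (D n) (d n)).toFinset 
  set r := √(d n * p n) with hr
  have hr2 : d n * p n = r * r :=
    (Real.mul_self_sqrt (mul_nonneg (hd n).le (p n).2.1)).symm
  have hr0 : 0 < r := by linarith
  have hcard : (highDegree (D n) (d n)).ncard = S.card := Set.ncard_eq_toFinset_card' _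
  have hcoe : (S : Set (Fin n)) = highDegree (D n) (d n) := Set.coe_toFinset _
  have hn0 : (0 : ℝ) < n := by exact_mod_cast hn
  have hSn : δ / 2 * n ≤ S.card := by
    rw [hcard, Real.norm_eq_abs, Real.norm_of_nonneg hn0.le] at h1
    have := (abs_le.1 h1).1
    linarith
  have hS0 : 0 < S.card := by
    have : (0 : ℝ) < S.card := lt_of_lt_of_le (by positivity) hSn
    exact_mod_cast this
  have hhigh : ∀ v ∈ S, d n ≤ D n v := fun v hv =>
    mem_highDegree.1 (Set.mem_toFinset.1 hv)
  calc _ = percolatedLaw (D n) (p n) {H | ∀ c : H.ConnectedComponent,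
        ((↑S ∩ c.supp).ncard : ℝ) < (1 - r⁻¹) * S.card} := by
        congr 1
        ext H
        simp [hcard, hcoe]
    _ ≤ _ := percolatedLaw_no_large_component_le (hD n) (p n) (hd n) (inv_pos.2 hr0)
        (by rw [one_div]; exact inv_anti₀ two_pos h2) hS0 hhigh
    _ ≤ _ := by
        refine ENNReal.ofReal_le_ofReal ?_
        have he : (p n : ℝ) * (r⁻¹ * S.card * d n) = r * S.card := by
          calc (p n : ℝ) * (r⁻¹ * S.card * d n) = (d n * p n) * r⁻¹ * S.card := by ring
            _ = r * S.card := by rw [hr2, mul_assoc r r, mul_inv_cancel₀ hr0.ne', mul_one]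
        have hpow : (1 / 2 : ℝ) ^ n = (2 : ℝ) ^ (-(n : ℝ)) := by
          rw [Real.rpow_neg two_pos.le, Real.rpow_natCast, one_div, inv_pow]
        rw [he, hpow]
        gcongr 5 * ?_
        refine Real.rpow_le_rpow_of_exponent_le one_le_two ?_
        have h4 : 128 ≤ r * δ := (div_le_iff₀ hδ).1 h3
        have h5 : r * (δ / 2 * n) ≤ r * S.card := by gcongr
        nlinarith

theorem le_largestComponent_of_supercritical (hD : ∀ n, Feasible (D n)) (hd : ∀ n, 0 < d n)
    (hδ : 0 ≤ δ)
    (hS : (fun n : ℕ => ((highDegree (D n) (d n)).ncard : ℝ) - δ * n)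
      =o[atTop] fun n : ℕ => (n : ℝ))
    (hp : (fun n => 1 / d n) =o[atTop] (fun n => (p n : ℝ))) :
    ∃ f : ℕ → ℝ, f =o[atTop] (fun n : ℕ => (n : ℝ)) ∧
      AAS (fun n => percolatedLaw (D n) (p n))
        (fun n => {H | δ * n - f n ≤ (largestComponent H : ℝ)}) := by
  have hprob := fun n => isProbabilityMeasure_percolatedLaw (hD n) (p n)
  rcases hδ.eq_or_lt with rfl | hδ
  · exact ⟨fun _ => 0, Asymptotics.isLittleO_zero _ _, by simp [AAS, Set.ofPred_true]⟩
  obtain ⟨ε, hε, h⟩ := exists_component_of_supercritical hD hd hδ hS hp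
  -- Chosen so that `δ * n - f n` equals `(1 - ε n) * |S|`.
  refine ⟨fun n => ε n * (highDegree (D n) (d n)).ncard
    - (((highDegree (D n) (d n)).ncard : ℝ) - δ * n), ?_, h.mono hprob fun n H hH => ?_⟩
  · refine Asymptotics.IsLittleO.sub (Asymptotics.IsBigO.trans_isLittleO ?_
      (natCast_mul_isLittleO hε)) hS
    refine Asymptotics.isBigO_of_le _ fun n => ?_
    have : (highDegree (D n) (d n)).ncard ≤ n := by
      simpa using Set.ncard_le_card (highDegree (D n) (d n))
    rw [norm_mul, norm_mul, mul_comm, Real.norm_natCast, Real.norm_natCast]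
    gcongr
  · obtain ⟨c, hc⟩ := hH
    have h1 : (highDegree (D n) (d n) ∩ c.supp).ncard ≤ largestComponent H :=
      (Set.ncard_le_ncard Set.inter_subset_right).trans (ncard_supp_le_largestComponent H c)
    have h2 : ((highDegree (D n) (d n) ∩ c.supp).ncard : ℝ) ≤ largestComponent H := by
      exact_mod_cast h1
    simp only [Set.mem_ofPred_eq]
    linarith

end Asymptotics

end DegreePercolation

theorem theorem1
    (D : ∀ n : ℕ, Fin n → ℕ) (hD : ∀ n, DegreePercolation.Feasible (D n))
    (d : ℕ → ℝ) (hd : ∀ n, 0 < d n) (δ : ℝ) (hδ : 0 ≤ δ)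
    (hS : (fun n : ℕ => ((DegreePercolation.highDegree (D n) (d n)).ncard : ℝ) - δ * n)
      =o[atTop] fun n : ℕ => (n : ℝ))
    (p : ℕ → unitInterval) :
    ((fun n => (p n : ℝ)) =o[atTop] (fun n => 1 / d n) →
      ∃ f : ℕ → ℝ, f =o[atTop] (fun n : ℕ => (n : ℝ)) ∧
        DegreePercolation.AAS (fun n => DegreePercolation.percolatedLaw (D n) (p n))
          (fun n => {H | (DegreePercolation.largestComponent H : ℝ) ≤ δ * n + f n})) ∧
    ((fun n => 1 / d n) =o[atTop] (fun n => (p n : ℝ)) →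
      (∃ f : ℕ → ℝ, f =o[atTop] (fun n : ℕ => (n : ℝ)) ∧
        DegreePercolation.AAS (fun n => DegreePercolation.percolatedLaw (D n) (p n))
          (fun n => {H | δ * n - f n ≤ (DegreePercolation.largestComponent H : ℝ)})) ∧
      (0 < δ →
        ∃ ε : ℕ → ℝ, Tendsto ε atTop (𝓝 0) ∧
          DegreePercolation.AAS (fun n => DegreePercolation.percolatedLaw (D n) (p n))
            (fun n => {H | ∃ c : H.ConnectedComponent,
              (1 - ε n) * ((DegreePercolation.highDegree (D n) (d n)).ncard : ℝ) ≤
                ((DegreePercolation.highDegree (D n) (d n) ∩ c.supp).ncard : ℝ)}))) := by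
  open DegreePercolation in
  exact ⟨largestComponent_le_of_subcritical hD hd hS, fun hp =>
    ⟨le_largestComponent_of_supercritical hD hd hδ hS hp,
      fun hδ' => exists_component_of_supercritical hD hd hδ' hS hp⟩⟩
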